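/- Call a subset of $\mathbb R^n$ discrete if it has no accumulation point in $\mathbb R^n$, and uniformly discrete if there is $\delta>0$ such that any two distinct points of it are at distance at least $\delta$. For a tempered distribution $\mu\in\mathcal S'(\mathbb R^d)$ and a real invertible $2d\times 2d$ matrix $T$, written in $d\times d$ blocks as $T=\begin{pmatrix}A_0&B_0\\C_0&D_0\end{pmatrix}$, the matrix-Wigner transform is the tempered distribution on $\mathbb R^{2d}=\mathbb R^d_x\times\mathbb R^d_\omega$ given by $W_T(\mu)=\mathcal F_2\big(P_T(\mu\otimes\overline\mu)\big)$, where $P_T$ is the change of variables $P_T F(z)=F(Tz)$ and $\mathcal F_2F(x,\omega)=\int_{\mathbb R^d} F(x,t)e^{-2\pi i\,\omega\cdot t}\,dt$, both extended to tempered distributions; for $\mu\in\mathcal S(\mathbb R^d)$ this means $W_T(\mu)(x,\omega)=\int_{\mathbb R^d} e^{-2\pi i\,t\cdot\omega}\mu(A_0x+B_0t)\overline{\mu(C_0x+D_0t)}\,dt$. Let $\Pi_1(E)=\{x:\exists\,\omega,\ (x,\omega)\in E\}$ be the projection of $E\subset\mathbb R^{2d}$ on the $x$-coordinate. Let $$\Lambda=\mathbb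 Z^2\cup\left\{\left(\sqrt2\,m_1,\ m_2+\tfrac12\right):\ m_1,m_2\in\mathbb Z\right\}\subset\mathbb R^2 .$$ Then: 1. $\Lambda$ is uniformly discrete. 2. For all invertible real $2\times2$ matrices $A,B$, the set $\Lambda+A^{-1}B(\Lambda)$ is not discrete. 3. There are no $\mu\in\mathcal S'(\mathbb R^2)$ and invertible real $4\times4$ matrix $T$ with $T^{-1}=\begin{pmatrix}A&B\\C&D\end{pmatrix}$ (in $2\times2$ blocks), $\det A\ne0$, $\det B\neq0$, such that $\operatorname{supp}\mu=\Lambda$ and $\Pi_1\big(\operatorname{supp}W_T(\mu)\big)$ is discrete. -/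

import Mathlib

open scoped SchwartzMap ContDiff LineDeriv Topology Matrix Pointwise

namespace MatrixWigner

section Slices

variable {E F G : Type*}
  [NormedAddCommGroup E] [NormedSpace ℝ E] [NormedAddCommGroup F] [NormedSpace ℝ F]
  [NormedAddCommGroup G] [NormedSpace ℝ G]

/-- The slice `y ↦ Φ (x, y)` of a Schwartz function of two variables. -/
noncomputable def slice (x : E) : 𝓢(E × F, ℂ) →L[ℂ] 𝓢(F, ℂ) :=
  SchwartzMap.compCLM ℂ (g := fun y : F => (x, y))
    (by
      have h : (fun y : F => (x, y)) =
          fun y => (x, (0 : F)) + ContinuousLinearMap.inr ℝ E F y := by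
        funext y; simp
      rw [h]
      exact (Function.HasTemperateGrowth.const _).add
        (ContinuousLinearMap.inr ℝ E F).hasTemperateGrowth)
    ⟨1, 1, fun y => by
      have h := norm_snd_le (x, y)
      simp only [pow_one, one_mul]
      linarith⟩

@[simp] theorem slice_apply (x : E) (Φ : 𝓢(E × F, ℂ)) (y : F) : slice x Φ y = Φ (x, y) := rfl

theorem lineDeriv_slice (x : E) (m : F) (Φ : 𝓢(E × F, ℂ)) :
    ∂_{m} (slice x Φ) = slice x (∂_{((0 : E), m)} Φ) := by
  ext y
  have h : HasFDerivAt (fun y : F => Φ (x, y))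
      ((fderiv ℝ Φ (x, y)).comp (ContinuousLinearMap.inr ℝ E F)) y :=
    (Φ.hasFDerivAt (x, y)).comp y (hasFDerivAt_prodMk_right x y)
  simp only [SchwartzMap.lineDerivOp_apply_eq_fderiv, slice_apply]
  change fderiv ℝ (fun y : F => Φ (x, y)) y m = _
  rw [h.fderiv]
  rfl

theorem lineDeriv_comm (m n : E) (Φ : 𝓢(E, ℂ)) : ∂_{m} (∂_{n} Φ) = ∂_{n} (∂_{m} Φ) := by
  ext x
  have hd : DifferentiableAt ℝ (fderiv ℝ Φ) x :=
    (SchwartzMap.fderivCLM ℝ E ℂ Φ).differentiableAt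
  have key : ∀ a b : E, ∂_{a} (∂_{b} Φ) x = fderiv ℝ (fderiv ℝ Φ) x a b := by
    intro a b
    rw [SchwartzMap.lineDerivOp_apply_eq_fderiv]
    change fderiv ℝ (fun z => fderiv ℝ Φ z b) x a = _
    rw [fderiv_clm_apply hd (differentiableAt_const b)]
    simp
  rw [key, key]
  exact ((Φ.smooth ⊤).contDiffAt.isSymmSndFDerivAt (by simp only [minSmoothness_of_isRCLikeNormedField]; exact WithTop.coe_le_coe.2 le_top)) m n

theorem exists_norm_iteratedFDeriv_succ_le [FiniteDimensional ℝ E] :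
    ∃ (s : Finset E) (C : ℝ), 0 ≤ C ∧ ∀ (n : ℕ) (f : E → ℂ), ContDiff ℝ ∞ f → ∀ z,
      ‖iteratedFDeriv ℝ (n + 1) f z‖ ≤
        C * ∑ m ∈ s, ‖iteratedFDeriv ℝ n (fun w => fderiv ℝ f w m) z‖ := by
  classical
  let b := Module.finBasis ℝ E
  let c : Fin (Module.finrank ℝ E) → (ℂ →L[ℝ] (E →L[ℝ] ℂ)) := fun i =>
    ContinuousLinearMap.smulRightL ℝ E ℂ (LinearMap.toContinuousLinearMap (b.coord i))
  refine ⟨Finset.univ.image b, ∑ i, ‖c i‖, by positivity, fun n f hf z => ?_⟩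
  have hder : ∀ m : E, ContDiff ℝ ∞ (fun w => fderiv ℝ f w m) := fun m =>
    (hf.fderiv_right (m := ∞) (by simp)).clm_apply contDiff_const
  have hEq : ∀ w, fderiv ℝ f w = ∑ i, c i (fderiv ℝ f w (b i)) := by
    intro w
    ext v
    conv_lhs => rw [← b.sum_repr v, map_sum]
    simp [c]
  have h1 : iteratedFDeriv ℝ n (fderiv ℝ f) z =
      ∑ i, iteratedFDeriv ℝ n (fun w => c i (fderiv ℝ f w (b i))) z := by
    refine Eq.trans (congrArg (fun g => iteratedFDeriv ℝ n g z) (funext hEq)) ?_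
    exact iteratedFDeriv_fun_sum_apply (f := fun i w => c i (fderiv ℝ f w (b i))) fun i _ =>
      (((c i).contDiff.comp (hder (b i))).of_le (mod_cast le_top)).contDiffAt
  · rw [← norm_iteratedFDeriv_fderiv, h1, Finset.sum_image b.injective.injOn, Finset.sum_mul]
    refine (norm_sum_le _ _).trans (Finset.sum_le_sum fun i _ => ?_)
    refine (ContinuousLinearMap.norm_iteratedFDeriv_comp_left (c i)
      ((hder (b i)).contDiffAt) (mod_cast le_top)).trans ?_
    gcongr
    exact Finset.single_le_sum
      (f := fun j => ‖iteratedFDeriv ℝ n (fun w => fderiv ℝ f w (b j)) z‖)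
      (fun _ _ => norm_nonneg _) (Finset.mem_univ i)

theorem slice_bound (x : E) (j k n : ℕ) (Φ : 𝓢(E × F, ℂ)) :
    ‖x‖ ^ j * SchwartzMap.seminorm ℂ k n (slice x Φ) ≤ SchwartzMap.seminorm ℂ (j + k) n Φ := by
  have key : ∀ y, ‖x‖ ^ j * (‖y‖ ^ k * ‖iteratedFDeriv ℝ n (slice x Φ) y‖) ≤
      SchwartzMap.seminorm ℂ (j + k) n Φ := by
    intro y
    have h1 : ‖iteratedFDeriv ℝ n (slice x Φ) y‖ ≤ ‖iteratedFDeriv ℝ n Φ (x, y)‖ := by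
      have e : (slice x Φ : F → ℂ) =
          (fun z => Φ ((x, 0) + z)) ∘ (ContinuousLinearMap.inr ℝ E F) := by
        funext y; simp
      have hs : ContDiff ℝ ∞ (fun z => Φ ((x, 0) + z)) :=
        (Φ.smooth ⊤).comp (contDiff_const.add contDiff_id)
      rw [e, ContinuousLinearMap.iteratedFDeriv_comp_right _ hs _ (mod_cast le_top),
        iteratedFDeriv_comp_add_left]
      refine (ContinuousMultilinearMap.norm_compContinuousLinearMap_le _ _).trans ?_
      have : ((x, 0) + ContinuousLinearMap.inr ℝ E F y : E × F) = (x, y) := by simp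
      rw [this]
      refine mul_le_of_le_one_right (norm_nonneg _) (Finset.prod_le_one (fun _ _ => norm_nonneg _)
        fun _ _ => ContinuousLinearMap.norm_inr_le_one ℝ E F)
    have h2 := Φ.le_seminorm ℂ (j + k) n (x, y)
    refine le_trans ?_ h2
    rw [pow_add, ← mul_assoc]
    gcongr
    · exact norm_fst_le (x, y)
    · exact norm_snd_le (x, y)
  rcases (pow_nonneg (norm_nonneg x) j).eq_or_lt with h0 | h0
  · rw [← h0, zero_mul]; exact apply_nonneg _ _
  · rw [← le_div_iff₀' h0]
    refine SchwartzMap.seminorm_le_bound ℂ k n _ (div_nonneg (apply_nonneg _ _) h0.le) fun y => ?_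
    rw [le_div_iff₀' h0]
    exact key y

/-- A continuous seminorm is dominated by a finite sum of the Schwartz seminorms. -/
theorem exists_le_sum {q : Seminorm ℂ 𝓢(E, ℂ)} (hq : Continuous q) :
    ∃ (s : Finset (ℕ × ℕ)) (C : ℝ), 0 ≤ C ∧
      ∀ f, q f ≤ C * ∑ i ∈ s, SchwartzMap.seminorm ℂ i.1 i.2 f := by
  obtain ⟨s, C, -, h⟩ := Seminorm.bound_of_continuous (schwartz_withSeminorms ℂ E ℂ) q hq
  refine ⟨s, C, C.2, fun f => (h f).trans ?_⟩
  change (C : ℝ) * _ ≤ _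
  gcongr
  refine Seminorm.finset_sup_apply_le (Finset.sum_nonneg fun _ _ => apply_nonneg _ _) fun i hi => ?_
  exact Finset.single_le_sum (f := fun i : ℕ × ℕ => SchwartzMap.seminorm ℂ i.1 i.2 f)
    (fun _ _ => apply_nonneg _ _) hi

theorem continuous_schwartz_seminorm (k n : ℕ) :
    Continuous (SchwartzMap.seminorm ℂ k n : Seminorm ℂ 𝓢(E, ℂ)) :=
  (schwartz_withSeminorms ℂ E ℂ).continuous_seminorm (k, n)

theorem exists_sum_le {ι : Type*} (s : Finset ι) (C : ℝ) (hC : 0 ≤ C)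
    (q : ι → Seminorm ℂ 𝓢(E, ℂ)) (hq : ∀ i, Continuous (q i)) :
    ∃ q' : Seminorm ℂ 𝓢(E, ℂ), Continuous q' ∧ ∀ f, C * ∑ i ∈ s, q i f ≤ q' f := by
  classical
  induction s using Finset.induction_on with
  | empty => exact ⟨0, continuous_const, fun f => by simp⟩
  | insert i s hi ih =>
    obtain ⟨q', h1, h2⟩ := ih
    lift C to NNReal using hC
    refine ⟨C • q i + q', ((hq i).const_smul C).add h1, fun f => ?_⟩
    rw [Finset.sum_insert hi, mul_add]
    exact add_le_add le_rfl (h2 f)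

theorem exists_comp (L : 𝓢(E, ℂ) →L[ℂ] 𝓢(F, ℂ)) {q : Seminorm ℂ 𝓢(F, ℂ)}
    (hq : Continuous q) : ∃ q' : Seminorm ℂ 𝓢(E, ℂ), Continuous q' ∧ ∀ f, q' f = q (L f) :=
  ⟨q.comp (L : 𝓢(E, ℂ) →ₗ[ℂ] 𝓢(F, ℂ)), hq.comp L.continuous, fun _ => rfl⟩

theorem exists_slice_le {q : Seminorm ℂ 𝓢(F, ℂ)} (hq : Continuous q) (j : ℕ) :
    ∃ q' : Seminorm ℂ 𝓢(E × F, ℂ), Continuous q' ∧ ∀ x Φ, ‖x‖ ^ j * q (slice x Φ) ≤ q' Φ := by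
  obtain ⟨s, C, hC, h⟩ := exists_le_sum hq
  obtain ⟨q', h1, h2⟩ := exists_sum_le (E := E × F) s C hC
    (fun i => SchwartzMap.seminorm ℂ (j + i.1) i.2) fun i => continuous_schwartz_seminorm _ _
  refine ⟨q', h1, fun x Φ => ?_⟩
  calc ‖x‖ ^ j * q (slice x Φ)
      ≤ ‖x‖ ^ j * (C * ∑ i ∈ s, SchwartzMap.seminorm ℂ i.1 i.2 (slice x Φ)) := by
        gcongr; exact h _
    _ = C * ∑ i ∈ s, ‖x‖ ^ j * SchwartzMap.seminorm ℂ i.1 i.2 (slice x Φ) := by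
        rw [mul_left_comm, Finset.mul_sum]
    _ ≤ C * ∑ i ∈ s, SchwartzMap.seminorm ℂ (j + i.1) i.2 Φ := by
        gcongr with i _; exact slice_bound _ _ _ _ _
    _ ≤ q' Φ := h2 Φ

theorem lineDeriv_seminorm_le (k n : ℕ) (m : E) (Φ : 𝓢(E, ℂ)) :
    SchwartzMap.seminorm ℂ k n (∂_{m} Φ) ≤ ‖m‖ * SchwartzMap.seminorm ℂ k (n + 1) Φ := by
  refine SchwartzMap.seminorm_le_bound ℂ k n _ (by positivity) fun x => ?_
  have h : ‖iteratedFDeriv ℝ n (fun z => fderiv ℝ Φ z m) x‖ ≤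
      ‖m‖ * ‖iteratedFDeriv ℝ (n + 1) Φ x‖ := by
    rw [← norm_iteratedFDeriv_fderiv]
    exact norm_iteratedFDeriv_clm_apply_const
      ((SchwartzMap.fderivCLM ℝ E ℂ Φ).smooth ⊤).contDiffAt (mod_cast le_top)
  calc ‖x‖ ^ k * ‖iteratedFDeriv ℝ n (∂_{m} Φ : 𝓢(E, ℂ)) x‖
      ≤ ‖x‖ ^ k * (‖m‖ * ‖iteratedFDeriv ℝ (n + 1) Φ x‖) := by gcongr; exact h
    _ = ‖m‖ * (‖x‖ ^ k * ‖iteratedFDeriv ℝ (n + 1) Φ x‖) := by ring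
    _ ≤ _ := by gcongr; exact Φ.le_seminorm ℂ k (n + 1) x

theorem exists_lineDeriv_le {q : Seminorm ℂ 𝓢(E, ℂ)} (hq : Continuous q) :
    ∃ q' : Seminorm ℂ 𝓢(E, ℂ), Continuous q' ∧ ∀ (m : E) Φ, q (∂_{m} Φ) ≤ ‖m‖ * q' Φ := by
  obtain ⟨s, C, hC, h⟩ := exists_le_sum hq
  obtain ⟨q', h1, h2⟩ := exists_sum_le (E := E) s C hC
    (fun i => SchwartzMap.seminorm ℂ i.1 (i.2 + 1)) fun i => continuous_schwartz_seminorm _ _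
  refine ⟨q', h1, fun m Φ => ?_⟩
  calc q (∂_{m} Φ) ≤ C * ∑ i ∈ s, SchwartzMap.seminorm ℂ i.1 i.2 (∂_{m} Φ) := h _
    _ ≤ C * ∑ i ∈ s, ‖m‖ * SchwartzMap.seminorm ℂ i.1 (i.2 + 1) Φ := by
        gcongr with i _; exact lineDeriv_seminorm_le _ _ _ _
    _ = ‖m‖ * (C * ∑ i ∈ s, SchwartzMap.seminorm ℂ i.1 (i.2 + 1) Φ) := by
        rw [← Finset.mul_sum, mul_left_comm]
    _ ≤ _ := by gcongr; exact h2 Φ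

/-- The first-order Taylor remainder of `x ↦ slice x Φ`. -/
noncomputable def remainder (x h : E) (Φ : 𝓢(E × F, ℂ)) : 𝓢(F, ℂ) :=
  slice (x + h) Φ - slice x Φ - slice x (∂_{(h, (0 : F))} Φ)

theorem lineDeriv_remainder (x h : E) (m : F) (Φ : 𝓢(E × F, ℂ)) :
    ∂_{m} (remainder x h Φ) = remainder x h (∂_{((0 : E), m)} Φ) := by
  have hs : ∀ f g : 𝓢(F, ℂ), ∂_{m} (f - g) = ∂_{m} f - ∂_{m} g := fun f g =>
    (LineDeriv.lineDerivOpCLM ℂ 𝓢(F, ℂ) m : 𝓢(F, ℂ) →L[ℂ] 𝓢(F, ℂ)).map_sub f g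
  simp only [remainder, hs, lineDeriv_slice, lineDeriv_comm (h, (0 : F))]

theorem remainder_bound_zero (k : ℕ) (x h : E) (Φ : 𝓢(E × F, ℂ)) :
    SchwartzMap.seminorm ℂ k 0 (remainder x h Φ) ≤
      ‖h‖ ^ 2 * SchwartzMap.seminorm ℂ k 2 Φ := by
  refine SchwartzMap.seminorm_le_bound ℂ k 0 _ (by positivity) fun y => ?_
  rw [norm_iteratedFDeriv_zero]
  rcases (pow_nonneg (norm_nonneg y) k).eq_or_lt with h0 | h0
  · rw [← h0, zero_mul]; positivity
  set K := SchwartzMap.seminorm ℂ k 2 Φ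
  set S : Set (E × F) := segment ℝ (x, y) (x + h, y) with hS
  have hSy : ∀ z ∈ S, z.2 = y := by
    rintro z ⟨a, b, -, -, hab, rfl⟩
    simp [← add_smul, hab]
  have hSn : ∀ z ∈ S, ‖z - (x, y)‖ ≤ ‖h‖ := by
    intro z hz
    refine (norm_sub_le_of_mem_segment hz).trans ?_
    simp
  have hx : (x, y) ∈ S := left_mem_segment _ _ _
  have hconv : Convex ℝ S := convex_segment _ _
  have hdiff : Differentiable ℝ (fderiv ℝ Φ) := (SchwartzMap.fderivCLM ℝ (E × F) ℂ Φ).differentiable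
  have h2 : ∀ z ∈ S, ‖fderiv ℝ (fderiv ℝ Φ) z‖ ≤ K / ‖y‖ ^ k := by
    intro z hz
    rw [le_div_iff₀' h0]
    have := Φ.le_seminorm ℂ k 2 z
    rw [← norm_iteratedFDeriv_fderiv, ← norm_iteratedFDeriv_fderiv, norm_iteratedFDeriv_zero]
      at this
    refine le_trans ?_ this
    gcongr
    rw [← hSy z hz]
    exact norm_snd_le z
  have h1 : ∀ z ∈ S, ‖fderiv ℝ Φ z - fderiv ℝ Φ (x, y)‖ ≤ K / ‖y‖ ^ k * ‖h‖ := by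
    intro z hz
    refine (hconv.norm_image_sub_le_of_norm_fderiv_le (fun z _ => hdiff z) h2 hx hz).trans ?_
    gcongr
    exact hSn z hz
  have h3 := hconv.norm_image_sub_le_of_norm_fderiv_le' (fun z _ => Φ.differentiableAt) h1 hx
    (right_mem_segment _ _ _)
  have e : (x + h, y) - (x, y) = (h, (0 : F)) := by simp
  rw [e] at h3
  have e2 : remainder x h Φ y = Φ (x + h, y) - Φ (x, y) - fderiv ℝ Φ (x, y) (h, 0) := rfl
  have e3 : ‖(h, (0 : F))‖ = ‖h‖ := by simp
  rw [e3] at h3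
  rw [e2]
  calc ‖y‖ ^ k * ‖_‖ ≤ ‖y‖ ^ k * (K / ‖y‖ ^ k * ‖h‖ * ‖h‖) := by gcongr
    _ = ‖h‖ ^ 2 * K := by field_simp

theorem exists_remainder_le_aux [FiniteDimensional ℝ F] (k n : ℕ) :
    ∃ q' : Seminorm ℂ 𝓢(E × F, ℂ), Continuous q' ∧ ∀ x h Φ,
      SchwartzMap.seminorm ℂ k n (remainder x h Φ) ≤ ‖h‖ ^ 2 * q' Φ := by
  induction n with
  | zero => exact ⟨_, continuous_schwartz_seminorm k 2, remainder_bound_zero k⟩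
  | succ n ih =>
    obtain ⟨q, hq, hle⟩ := ih
    obtain ⟨s, C, hC, hs⟩ := exists_norm_iteratedFDeriv_succ_le (E := F)
    choose Q hQ hQ' using fun m : F =>
      exists_comp (LineDeriv.lineDerivOpCLM ℂ 𝓢(E × F, ℂ) ((0 : E), m)) hq
    obtain ⟨q', h1, h2⟩ := exists_sum_le s C hC Q hQ
    refine ⟨q', h1, fun x h Φ => ?_⟩
    refine SchwartzMap.seminorm_le_bound ℂ k (n + 1) _ (by positivity) fun y => ?_
    calc ‖y‖ ^ k * ‖iteratedFDeriv ℝ (n + 1) (remainder x h Φ) y‖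
        ≤ ‖y‖ ^ k * (C * ∑ m ∈ s, ‖iteratedFDeriv ℝ n (∂_{m} (remainder x h Φ) : 𝓢(F, ℂ)) y‖) := by
          gcongr; exact hs n _ ((remainder x h Φ).smooth ⊤) y
      _ = C * ∑ m ∈ s,
            ‖y‖ ^ k * ‖iteratedFDeriv ℝ n (∂_{m} (remainder x h Φ) : 𝓢(F, ℂ)) y‖ := by
          rw [mul_left_comm, Finset.mul_sum]
      _ ≤ C * ∑ m ∈ s, ‖h‖ ^ 2 * Q m Φ := by
          refine mul_le_mul_of_nonneg_left (Finset.sum_le_sum fun m _ => ?_) hC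
          refine (SchwartzMap.le_seminorm ℂ k n (∂_{m} (remainder x h Φ) : 𝓢(F, ℂ)) y).trans ?_
          rw [lineDeriv_remainder, hQ']
          exact hle _ _ _
      _ = ‖h‖ ^ 2 * (C * ∑ m ∈ s, Q m Φ) := by rw [← Finset.mul_sum, mul_left_comm]
      _ ≤ _ := by gcongr; exact h2 Φ

theorem exists_remainder_le [FiniteDimensional ℝ F] {q : Seminorm ℂ 𝓢(F, ℂ)}
    (hq : Continuous q) :
    ∃ q' : Seminorm ℂ 𝓢(E × F, ℂ), Continuous q' ∧ ∀ x h Φ,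
      q (remainder x h Φ) ≤ ‖h‖ ^ 2 * q' Φ := by
  obtain ⟨s, C, hC, hs⟩ := exists_le_sum hq
  choose Q hQ hQ' using fun i : ℕ × ℕ => exists_remainder_le_aux (E := E) (F := F) i.1 i.2
  obtain ⟨q', h1, h2⟩ := exists_sum_le s C hC Q hQ
  refine ⟨q', h1, fun x h Φ => ?_⟩
  calc q (remainder x h Φ)
      ≤ C * ∑ i ∈ s, SchwartzMap.seminorm ℂ i.1 i.2 (remainder x h Φ) := hs _
    _ ≤ C * ∑ i ∈ s, ‖h‖ ^ 2 * Q i Φ := by gcongr with i _; exact hQ' i x h Φ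
    _ = ‖h‖ ^ 2 * (C * ∑ i ∈ s, Q i Φ) := by rw [← Finset.mul_sum, mul_left_comm]
    _ ≤ _ := by gcongr; exact h2 Φ

/-- `L` acting on the second variable of a Schwartz function, as a plain function. -/
noncomputable def mapSndFun (L : 𝓢(F, ℂ) →L[ℂ] 𝓢(G, ℂ)) (Φ : 𝓢(E × F, ℂ)) (z : E × G) : ℂ :=
  L (slice z.1 Φ) z.2

theorem mapSndFun_bound (L : 𝓢(F, ℂ) →L[ℂ] 𝓢(G, ℂ)) (k : ℕ) :
    ∃ q : Seminorm ℂ 𝓢(E × F, ℂ), Continuous q ∧ ∀ Φ z, ‖z‖ ^ k * ‖mapSndFun L Φ z‖ ≤ q Φ := by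
  obtain ⟨q1, hq1, h1⟩ := exists_comp L (continuous_schwartz_seminorm 0 0)
  obtain ⟨q2, hq2, h2⟩ := exists_comp L (continuous_schwartz_seminorm k 0)
  obtain ⟨q3, hq3, h3⟩ := exists_slice_le (E := E) hq1 k
  obtain ⟨q4, hq4, h4⟩ := exists_slice_le (E := E) hq2 0
  refine ⟨q3 + q4, hq3.add hq4, fun Φ z => ?_⟩
  have h5 : ‖z.1‖ ^ k * ‖mapSndFun L Φ z‖ ≤ q3 Φ := by
    refine le_trans ?_ (h3 z.1 Φ)
    rw [h1]
    gcongr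
    exact SchwartzMap.norm_le_seminorm ℂ _ _
  have h6 : ‖z.2‖ ^ k * ‖mapSndFun L Φ z‖ ≤ q4 Φ := by
    refine le_trans ?_ (h4 z.1 Φ)
    rw [h2, pow_zero, one_mul]
    exact SchwartzMap.norm_pow_mul_le_seminorm ℂ _ _ _
  have h7 : 0 ≤ q3 Φ := apply_nonneg _ _
  have h8 : 0 ≤ q4 Φ := apply_nonneg _ _
  change _ ≤ q3 Φ + q4 Φ
  rcases max_cases ‖z.1‖ ‖z.2‖ with ⟨h, -⟩ | ⟨h, -⟩
  · rw [Prod.norm_def, h]; linarith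
  · rw [Prod.norm_def, h]; linarith

variable [FiniteDimensional ℝ E] [FiniteDimensional ℝ F]

theorem mapSndFun_hasFDerivAt (L : 𝓢(F, ℂ) →L[ℂ] 𝓢(G, ℂ)) (Φ : 𝓢(E × F, ℂ)) (z : E × G) :
    ∃ D : E × G →L[ℝ] ℂ, HasFDerivAt (mapSndFun L Φ) D z ∧ ∀ m, D m =
      mapSndFun L (∂_{(m.1, (0 : F))} Φ) z +
      mapSndFun ((LineDeriv.lineDerivOpCLM ℂ 𝓢(G, ℂ) m.2).comp L) Φ z := by
  obtain ⟨x, y⟩ := z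
  obtain ⟨q1, hq1, h1⟩ := exists_comp L (continuous_schwartz_seminorm 0 0)
  obtain ⟨r1, hr1, h1'⟩ := exists_remainder_le (E := E) hq1
  obtain ⟨q2, hq2, h2⟩ := exists_comp L (continuous_schwartz_seminorm 0 1)
  obtain ⟨q3, hq3, h3⟩ := exists_slice_le (E := E) hq2 0
  obtain ⟨r3, hr3, h3'⟩ := exists_lineDeriv_le hq3
  have hadd : ∀ a b : E, (∂_{(a + b, (0 : F))} Φ : 𝓢(E × F, ℂ)) =
      ∂_{(a, (0 : F))} Φ + ∂_{(b, (0 : F))} Φ := by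
    intro a b
    ext w
    simp only [SchwartzMap.lineDerivOp_apply_eq_fderiv, _root_.add_apply, ← map_add]
    simp
  have hsmul : ∀ (c : ℝ) (a : E), (∂_{(c • a, (0 : F))} Φ : 𝓢(E × F, ℂ)) =
      (c : ℂ) • ∂_{(a, (0 : F))} Φ := by
    intro c a
    ext w
    have : (c • a, (0 : F)) = c • (a, (0 : F)) := by simp
    simp only [SchwartzMap.lineDerivOp_apply_eq_fderiv, _root_.smul_apply, this, map_smul]
    simp
  let B : E →L[ℝ] ℂ := LinearMap.toContinuousLinearMap
    { toFun := fun a => L (slice x (∂_{(a, (0 : F))} Φ)) y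
      map_add' := fun a b => by simp [hadd]
      map_smul' := fun c a => by simp [hsmul] }
  have hB : ∀ a, B a = L (slice x (∂_{(a, (0 : F))} Φ)) y := fun _ => rfl
  set g := L (slice x Φ) with hg
  refine ⟨B.comp (ContinuousLinearMap.fst ℝ E G) +
    (fderiv ℝ g y).comp (ContinuousLinearMap.snd ℝ E G), ?_, fun m => rfl⟩
  let r : E × G → ℂ := fun w => mapSndFun L Φ w - (B (w.1 - x) + g w.2)
  have hr : HasFDerivAt r (0 : E × G →L[ℝ] ℂ) (x, y) := by
    refine Asymptotics.IsBigO.hasFDerivAt (n := 2) ?_ one_lt_two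
    refine Asymptotics.IsBigO.of_bound (r1 Φ + r3 Φ) (Filter.Eventually.of_forall fun w => ?_)
    obtain ⟨u, v⟩ := w
    have hd : r (u, v) = L (remainder x (u - x) Φ) v +
        (L (slice x (∂_{(u - x, (0 : F))} Φ)) v - L (slice x (∂_{(u - x, (0 : F))} Φ)) y) := by
      simp only [r, mapSndFun, hB, remainder, map_sub, _root_.sub_apply, hg,
        add_sub_cancel]
      ring
    have b1 : ‖L (remainder x (u - x) Φ) v‖ ≤ ‖u - x‖ ^ 2 * r1 Φ := by
      refine (SchwartzMap.norm_le_seminorm ℂ _ _).trans ?_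
      rw [← h1]
      exact h1' _ _ _
    have b2 : ‖L (slice x (∂_{(u - x, (0 : F))} Φ)) v - L (slice x (∂_{(u - x, (0 : F))} Φ)) y‖ ≤
        ‖u - x‖ * r3 Φ * ‖v - y‖ := by
      refine convex_univ.norm_image_sub_le_of_norm_fderiv_le (𝕜 := ℝ)
        (fun _ _ => SchwartzMap.differentiableAt _) (fun w _ => ?_) trivial trivial
      rw [← norm_iteratedFDeriv_one]
      refine (SchwartzMap.norm_iteratedFDeriv_le_seminorm ℂ _ 1 _).trans ?_
      rw [← h2]
      have := h3 x (∂_{(u - x, (0 : F))} Φ)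
      rw [pow_zero, one_mul] at this
      refine this.trans ((h3' _ _).trans ?_)
      simp
    have n1 : ‖u - x‖ ≤ ‖(u, v) - (x, y)‖ := norm_fst_le ((u, v) - (x, y))
    have n2 : ‖v - y‖ ≤ ‖(u, v) - (x, y)‖ := norm_snd_le ((u, v) - (x, y))
    have p1 : 0 ≤ r1 Φ := apply_nonneg _ _
    have p3 : 0 ≤ r3 Φ := apply_nonneg _ _
    rw [hd, Real.norm_of_nonneg (by positivity)]
    calc _ ≤ ‖u - x‖ ^ 2 * r1 Φ + ‖u - x‖ * r3 Φ * ‖v - y‖ :=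
          (norm_add_le _ _).trans (add_le_add b1 b2)
      _ ≤ ‖(u, v) - (x, y)‖ ^ 2 * r1 Φ + ‖(u, v) - (x, y)‖ * r3 Φ * ‖(u, v) - (x, y)‖ := by
          gcongr
      _ = _ := by ring
  have hA : HasFDerivAt (fun w : E × G => B (w.1 - x)) (B.comp (ContinuousLinearMap.fst ℝ E G))
      (x, y) := by
    exact B.hasFDerivAt.comp (x, y) (hasFDerivAt_fst.sub_const x)
  have hG : HasFDerivAt (fun w : E × G => g w.2)
      ((fderiv ℝ g y).comp (ContinuousLinearMap.snd ℝ E G)) (x, y) :=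
    (g.hasFDerivAt y).comp (x, y) hasFDerivAt_snd
  have := hr.add (hA.add hG)
  rw [zero_add] at this
  refine this.congr_of_eventuallyEq (Filter.Eventually.of_forall fun w => ?_)
  simp [r]

theorem mapSndFun_fderiv (L : 𝓢(F, ℂ) →L[ℂ] 𝓢(G, ℂ)) (Φ : 𝓢(E × F, ℂ)) (m : E × G) :
    (fun z => fderiv ℝ (mapSndFun L Φ) z m) = fun z => mapSndFun L (∂_{(m.1, (0 : F))} Φ) z +
      mapSndFun ((LineDeriv.lineDerivOpCLM ℂ 𝓢(G, ℂ) m.2).comp L) Φ z := by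
  funext z
  obtain ⟨D, hD, h⟩ := mapSndFun_hasFDerivAt L Φ z
  rw [hD.fderiv, h]

variable [FiniteDimensional ℝ G]

theorem mapSndFun_contDiff (L : 𝓢(F, ℂ) →L[ℂ] 𝓢(G, ℂ)) (Φ : 𝓢(E × F, ℂ)) :
    ContDiff ℝ ∞ (mapSndFun L Φ : E × G → ℂ) := by
  rw [contDiff_infty]
  intro n
  induction n generalizing L Φ with
  | zero =>
    refine contDiff_zero.2 (continuous_iff_continuousAt.2 fun z => ?_)
    obtain ⟨D, hD, -⟩ := mapSndFun_hasFDerivAt L Φ z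
    exact hD.continuousAt
  | succ n ih =>
    push_cast
    rw [contDiff_succ_iff_fderiv_apply]
    refine ⟨fun z => ?_, by simp, fun m => ?_⟩
    · obtain ⟨D, hD, -⟩ := mapSndFun_hasFDerivAt L Φ z
      exact hD.differentiableAt
    · rw [mapSndFun_fderiv]
      exact (ih _ _).add (ih _ _)

theorem mapSndFun_decay (k n : ℕ) (L : 𝓢(F, ℂ) →L[ℂ] 𝓢(G, ℂ)) :
    ∃ q : Seminorm ℂ 𝓢(E × F, ℂ), Continuous q ∧ ∀ Φ z,
      ‖z‖ ^ k * ‖iteratedFDeriv ℝ n (mapSndFun L Φ) z‖ ≤ q Φ := by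
  induction n generalizing L with
  | zero => simpa only [norm_iteratedFDeriv_zero] using mapSndFun_bound L k
  | succ n ih =>
    obtain ⟨s, C, hC, hs⟩ := exists_norm_iteratedFDeriv_succ_le (E := E × G)
    obtain ⟨q0, hq0, h0⟩ := ih L
    choose Q hQ hQ' using fun m : E × G => exists_comp
      (LineDeriv.lineDerivOpCLM ℂ 𝓢(E × F, ℂ) (m.1, (0 : F))) hq0
    choose R hR hR' using fun m : E × G =>
      ih ((LineDeriv.lineDerivOpCLM ℂ 𝓢(G, ℂ) m.2).comp L)
    obtain ⟨q', h1, h2⟩ := exists_sum_le s C hC (fun m => Q m + R m)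
      (fun m => (hQ m).add (hR m))
    refine ⟨q', h1, fun Φ z => ?_⟩
    calc ‖z‖ ^ k * ‖iteratedFDeriv ℝ (n + 1) (mapSndFun L Φ) z‖
        ≤ ‖z‖ ^ k * (C * ∑ m ∈ s,
            ‖iteratedFDeriv ℝ n (fun w => fderiv ℝ (mapSndFun L Φ) w m) z‖) := by
          gcongr; exact hs n _ (mapSndFun_contDiff L Φ) z
      _ = C * ∑ m ∈ s, ‖z‖ ^ k *
            ‖iteratedFDeriv ℝ n (fun w => fderiv ℝ (mapSndFun L Φ) w m) z‖ := by
          rw [mul_left_comm, Finset.mul_sum]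
      _ ≤ C * ∑ m ∈ s, (Q m + R m) Φ := by
          gcongr with m _
          rw [mapSndFun_fderiv, fun_iteratedFDeriv_add_apply
            ((mapSndFun_contDiff _ _).of_le (mod_cast le_top)).contDiffAt
            ((mapSndFun_contDiff _ _).of_le (mod_cast le_top)).contDiffAt]
          refine (mul_le_mul_of_nonneg_left (norm_add_le _ _) (by positivity)).trans ?_
          rw [mul_add]
          refine add_le_add ?_ (hR' m Φ z)
          rw [hQ']
          exact h0 _ z
      _ ≤ _ := h2 Φ

/-- A continuous linear operator `L` acting on the second variable of Schwartz functions: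
`(x, y) ↦ (L (Φ (x, ·))) y`. -/
noncomputable def mapSnd (L : 𝓢(F, ℂ) →L[ℂ] 𝓢(G, ℂ)) : 𝓢(E × F, ℂ) →L[ℂ] 𝓢(E × G, ℂ) :=
  SchwartzMap.mkCLM (fun Φ z => L (slice z.1 Φ) z.2)
    (fun Φ Ψ z => by simp) (fun a Φ z => by simp) (fun Φ => mapSndFun_contDiff L Φ)
    (fun n => by
      obtain ⟨q, hq, h⟩ := mapSndFun_decay (E := E) n.1 n.2 L
      obtain ⟨s, C, -, hC⟩ := Seminorm.bound_of_continuous (schwartz_withSeminorms ℂ (E × F) ℂ) q hq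
      exact ⟨s, C, C.2, fun Φ z => (h Φ z).trans (hC Φ)⟩)

@[simp] theorem mapSnd_apply (L : 𝓢(F, ℂ) →L[ℂ] 𝓢(G, ℂ)) (Φ : 𝓢(E × F, ℂ)) (x : E) (y : G) :
    mapSnd L Φ (x, y) = L (slice x Φ) y := rfl


/-- A tempered distribution applied to the second variable of a Schwartz function:
`x ↦ ν (Φ (x, ·))`. -/
noncomputable def evalSnd (ν : 𝓢'(F, ℂ)) : 𝓢(E × F, ℂ) →L[ℂ] 𝓢(E, ℂ) :=
  (SchwartzMap.compCLMOfContinuousLinearEquiv ℂ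
    (ContinuousLinearEquiv.prodUnique ℝ E PUnit.{1}).symm).comp
    (mapSnd (ContinuousLinearMap.smulRight (M₁ := 𝓢(F, ℂ)) (R := ℂ) (S := ℂ) ν
      (HasCompactSupport.toSchwartzMap (f := fun _ : PUnit.{1} => (1 : ℂ)) (HasCompactSupport.of_compactSpace _) contDiff_const)))

@[simp] theorem evalSnd_apply (ν : 𝓢'(F, ℂ)) (Φ : 𝓢(E × F, ℂ)) (x : E) :
    evalSnd ν Φ x = ν (slice x Φ) :=
  mul_one (ν (slice x Φ))

/-- The tensor product of tempered distributions, `Φ ↦ μ (x ↦ ν (Φ (x, ·)))`. -/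
noncomputable def tensor (μ : 𝓢'(E, ℂ)) (ν : 𝓢'(F, ℂ)) : 𝓢'(E × F, ℂ) :=
  PointwiseConvergenceCLM.precomp ℂ (evalSnd ν) μ

theorem tensor_apply (μ : 𝓢'(E, ℂ)) (ν : 𝓢'(F, ℂ)) (Φ : 𝓢(E × F, ℂ)) :
    tensor μ ν Φ = μ (evalSnd ν Φ) := rfl

end Slices

section Conj

variable {E : Type*} [NormedAddCommGroup E] [NormedSpace ℝ E]

/-- The complex conjugate of a tempered distribution, `φ ↦ conj (μ (conj φ))`. -/
noncomputable def conjDist (μ : 𝓢'(E, ℂ)) : 𝓢'(E, ℂ) :=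
  ContinuousLinearMap.toPointwiseConvergenceCLM _ _ _ _
    { toFun := fun φ => starRingEnd ℂ (μ (φ.postcompCLM (Complex.conjCLE : ℂ →L[ℝ] ℂ)))
      map_add' := fun φ ψ => by rw [map_add, map_add, map_add]
      map_smul' := fun c φ => by
        have h : (c • φ).postcompCLM (Complex.conjCLE : ℂ →L[ℝ] ℂ) =
            starRingEnd ℂ c • φ.postcompCLM (Complex.conjCLE : ℂ →L[ℝ] ℂ) := by
          ext x; simp
        rw [h, map_smul]
        simp
      cont := Complex.continuous_conj.comp (μ.cont.comp
        (SchwartzMap.postcompCLM (Complex.conjCLE : ℂ →L[ℝ] ℂ)).cont) }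

theorem conjDist_apply (μ : 𝓢'(E, ℂ)) (φ : 𝓢(E, ℂ)) : conjDist μ φ =
    starRingEnd ℂ (μ (φ.postcompCLM (Complex.conjCLE : ℂ →L[ℝ] ℂ))) := rfl

end Conj

/-- `ℝᵈ` with its Euclidean structure. -/
abbrev Eucl (d : ℕ) : Type := EuclideanSpace ℝ (Fin d)

section Wigner

variable {d : ℕ}

/-- The identification of `ℝᵈ × ℝᵈ` with `ℝ²ᵈ`. -/
def pairEquiv (d : ℕ) : (Eucl d × Eucl d) ≃ₗ[ℝ] (Fin d ⊕ Fin d → ℝ) :=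
  ((WithLp.linearEquiv 2 ℝ (Fin d → ℝ)).prodCongr (WithLp.linearEquiv 2 ℝ (Fin d → ℝ))).trans
    (LinearEquiv.sumArrowLequivProdArrow (Fin d) (Fin d) ℝ ℝ).symm

/-- The linear change of variables `(x, t) ↦ T (x, t)` of `ℝ²ᵈ = ℝᵈ × ℝᵈ`. -/
noncomputable def blockEquiv (T : GL (Fin d ⊕ Fin d) ℝ) :
    (Eucl d × Eucl d) ≃L[ℝ] (Eucl d × Eucl d) :=
  LinearEquiv.toContinuousLinearEquiv
    (((pairEquiv d).trans (LinearMap.GeneralLinearGroup.generalLinearEquiv ℝ _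
      (Matrix.GeneralLinearGroup.toLin T))).trans (pairEquiv d).symm)

/-- With `T` written in blocks, `T (x, t) = (A₀ x + B₀ t, C₀ x + D₀ t)`. -/
theorem blockEquiv_apply (T : GL (Fin d ⊕ Fin d) ℝ) (A₀ B₀ C₀ D₀ : Matrix (Fin d) (Fin d) ℝ)
    (hT : (T : Matrix (Fin d ⊕ Fin d) (Fin d ⊕ Fin d) ℝ) = Matrix.fromBlocks A₀ B₀ C₀ D₀)
    (x t : Eucl d) :
    blockEquiv T (x, t) = (WithLp.toLp 2 (A₀ *ᵥ x.ofLp + B₀ *ᵥ t.ofLp),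
      WithLp.toLp 2 (C₀ *ᵥ x.ofLp + D₀ *ᵥ t.ofLp)) := by
  have h : blockEquiv T (x, t) = (pairEquiv d).symm
      ((T : Matrix (Fin d ⊕ Fin d) (Fin d ⊕ Fin d) ℝ) *ᵥ pairEquiv d (x, t)) := rfl
  have h2 : pairEquiv d (x, t) = Sum.elim x.ofLp t.ofLp := by
    funext i; cases i <;> rfl
  rw [h, h2, hT, Matrix.fromBlocks_mulVec, LinearEquiv.symm_apply_eq]
  funext i
  cases i <;> rfl

/-- The change of variable operator `P_T`, which is `Φ ↦ Φ (T ·)` on functions. -/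
noncomputable def changeVar (T : GL (Fin d ⊕ Fin d) ℝ) (u : 𝓢'(Eucl d × Eucl d, ℂ)) :
    𝓢'(Eucl d × Eucl d, ℂ) :=
  ((|(T : Matrix (Fin d ⊕ Fin d) (Fin d ⊕ Fin d) ℝ).det|⁻¹ : ℝ) : ℂ) •
    PointwiseConvergenceCLM.precomp ℂ
      (SchwartzMap.compCLMOfContinuousLinearEquiv ℂ (blockEquiv T).symm) u

/-- The partial Fourier transform in the second variable,
`F ↦ ∫ F (x, t) exp (-2 π i ω · t) dt` on functions, extended by duality to distributions. -/
noncomputable def partialFourier (u : 𝓢'(Eucl d × Eucl d, ℂ)) : 𝓢'(Eucl d × Eucl d, ℂ) :=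
  PointwiseConvergenceCLM.precomp ℂ (mapSnd (FourierTransform.fourierCLM ℂ 𝓢(Eucl d, ℂ))) u

/-- The matrix-Wigner transform `W_T(μ) = 𝓕₂ (P_T (μ ⊗ conj μ))`. -/
noncomputable def wigner (T : GL (Fin d ⊕ Fin d) ℝ) (μ : 𝓢'(Eucl d, ℂ)) :
    𝓢'(Eucl d × Eucl d, ℂ) :=
  partialFourier (changeVar T (tensor μ (conjDist μ)))

/-- A set with no accumulation point in the whole space (hence closed). -/
def IsDiscreteSet {X : Type*} [TopologicalSpace X] (S : Set X) : Prop :=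
  ∀ x, ¬ AccPt x (Filter.principal S)

/-- Distinct points of the set are at distance at least some fixed `δ > 0`. -/
def IsUniformlyDiscrete {X : Type*} [MetricSpace X] (S : Set X) : Prop :=
  ∃ δ : ℝ, 0 < δ ∧ ∀ r ∈ S, ∀ s ∈ S, r ≠ s → δ ≤ dist r s

/-- `M(K) = {M k : k ∈ K}`. -/
def matImage (M : Matrix (Fin d) (Fin d) ℝ) (K : Set (Eucl d)) : Set (Eucl d) :=
  (fun k => WithLp.toLp 2 (M *ᵥ k.ofLp)) '' K

/-- The projection `Π₁` of a subset of `ℝᵈ × ℝᵈ` on the first coordinate. -/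
def proj₁ (S : Set (Eucl d × Eucl d)) : Set (Eucl d) :=
  {x | ∃ w, (x, w) ∈ S}

end Wigner

/-- `ℤ² ∪ {(√2 m₁, m₂ + 1/2) : m₁, m₂ ∈ ℤ}`. -/
def exampleSet : Set (Eucl 2) :=
  {z | ∃ m₁ m₂ : ℤ, z = !₂[(m₁ : ℝ), (m₂ : ℝ)]} ∪
    {z | ∃ m₁ m₂ : ℤ, z = !₂[√2 * (m₁ : ℝ), (m₂ : ℝ) + 1 / 2]}

end MatrixWigner

namespace MatrixWigner

open Filter Distribution

/-! ### Vanishing of a tempered distribution off its support -/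

section Support

variable {E : Type*} [NormedAddCommGroup E] [NormedSpace ℝ E]

/-! The arithmetic obstruction is that the two pieces of `exampleSet` contain progressions in the
same direction with incommensurable steps 1 and √2. Put M = A⁻¹B and w = M(1,0) ≠ 0. The sumset
contains ℤ² + kw and ℤ² + k√2 w + v for all integers k, with v = M(0,1/2). Reduced modulo ℤ², each
progression stays in a bounded region, so discreteness makes two of its terms coincide: some nonzero
integer multiples of w and of √2 w lie in ℤ². Comparing a nonzero coordinate of w makes √2 rational
(`exists_mul_eq_int_of_isDiscreteSet`).

The analytic part reduces the Wigner statement to this one. The partial Fourier transform acts on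
the second variable only, so it cannot remove mass over a given x. Hence the closure of the
projected support of W_T(μ) contains Aa + Bb for all a, b in supp μ (`fst_symm_mem_closure_proj₁`).
A discrete projection is closed, and pulling it back along the injective A makes supp μ + M(supp μ)
discrete.

The test functions used there are inverse partial Fourier transforms, for which compact support in ω
is not available. This is why a distribution must first be shown to vanish on every Schwartz
function supported off its support, which is done by cutoffs (`isVanishingOn_compl_dsupport`). -/

theorem norm_iteratedFDeriv_dilate_sub_one_le (χ : 𝓢(E, ℂ)) {c : ℝ} (hc0 : 0 ≤ c) (hc1 : c ≤ 1)
    (i : ℕ) (x : E) :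
    ‖iteratedFDeriv ℝ i (fun y => χ (c • y) - 1) x‖ ≤ SchwartzMap.seminorm ℂ 0 i χ + 1 := by
  have hχ : ContDiff ℝ i χ := χ.smooth i
  have hd : ContDiff ℝ i (fun y => χ (c • y)) := hχ.comp (contDiff_const_smul c)
  have h1 : ‖iteratedFDeriv ℝ i (fun _ : E => (1 : ℂ)) x‖ ≤ 1 := by
    rcases Nat.eq_zero_or_pos i with rfl | hi
    · simp
    · rw [iteratedFDeriv_const_of_ne hi.ne']; simp
  have e : iteratedFDeriv ℝ i (fun y => χ (c • y) - 1) x =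
      iteratedFDeriv ℝ i (fun y => χ (c • y)) x - iteratedFDeriv ℝ i (fun _ : E => (1 : ℂ)) x :=
    iteratedFDeriv_sub_apply (f := fun y => χ (c • y)) hd.contDiffAt contDiff_const.contDiffAt
  rw [e]
  refine (norm_sub_le _ _).trans (add_le_add ?_ h1)
  -- Dilation multiplies the i-th derivative by cⁱ ≤ 1, so the bound is uniform in c.
  rw [iteratedFDeriv_comp_const_smul c hχ]
  rw [norm_smul]
  refine (mul_le_of_le_one_left (norm_nonneg _) ?_).trans
    (SchwartzMap.norm_iteratedFDeriv_le_seminorm ℂ χ i _)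
  rw [norm_pow, Real.norm_of_nonneg hc0]
  exact pow_le_one₀ hc0 hc1

theorem hasTemperateGrowth_dilate (χ : 𝓢(E, ℂ)) (c : ℝ) :
    Function.HasTemperateGrowth (fun x => χ (c • x)) :=
  χ.hasTemperateGrowth.comp (c • ContinuousLinearMap.id ℝ E).hasTemperateGrowth

/-- Multiplying by a wide cutoff moves a Schwartz function by little. -/
theorem seminorm_cutoff_sub_le (χ Φ : 𝓢(E, ℂ)) (hχ : ∀ x, ‖x‖ < 1 → χ x = 1) {c : ℝ}
    (hc0 : 0 < c) (hc1 : c ≤ 1) (k n : ℕ) :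
    SchwartzMap.seminorm ℂ k n (SchwartzMap.smulLeftCLM ℂ (fun x => χ (c • x)) Φ - Φ) ≤
      c * ∑ i ∈ Finset.range (n + 1), (n.choose i : ℝ) *
        (SchwartzMap.seminorm ℂ 0 i χ + 1) * SchwartzMap.seminorm ℂ (k + 1) (n - i) Φ := by
  have hS : 0 ≤ ∑ i ∈ Finset.range (n + 1), (n.choose i : ℝ) *
        (SchwartzMap.seminorm ℂ 0 i χ + 1) * SchwartzMap.seminorm ℂ (k + 1) (n - i) Φ := by
    refine Finset.sum_nonneg fun i _ => ?_
    have := apply_nonneg (SchwartzMap.seminorm ℂ 0 i) χ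
    positivity
  refine SchwartzMap.seminorm_le_bound ℂ k n _ (mul_nonneg hc0.le hS) fun x => ?_
  have e : ((SchwartzMap.smulLeftCLM ℂ (fun x => χ (c • x)) Φ - Φ : 𝓢(E, ℂ)) : E → ℂ) =
      fun y => (χ (c • y) - 1) * Φ y := by
    funext y
    simp [hasTemperateGrowth_dilate χ c, sub_mul]
  rw [e]
  -- Where ‖cx‖ < 1 the cutoff is 1 near x and the difference vanishes there. Elsewhere 1 ≤ c‖x‖, so
  -- one extra power of ‖x‖ buys the factor c.
  rcases lt_or_ge ‖c • x‖ 1 with hx | hx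
  · have h0 : (fun y => (χ (c • y) - 1) * Φ y) =ᶠ[𝓝 x] fun _ => 0 := by
      have : ∀ᶠ y in 𝓝 x, ‖c • y‖ < 1 :=
        (continuous_const_smul c).norm.continuousAt.eventually_lt continuousAt_const hx
      filter_upwards [this] with y hy
      rw [hχ _ hy, sub_self, zero_mul]
    rw [(h0.iteratedFDeriv ℝ n).self_of_nhds]
    have : iteratedFDeriv ℝ n (fun _ : E => (0 : ℂ)) x = 0 := by
      simp
    rw [this, norm_zero, mul_zero]
    exact mul_nonneg hc0.le hS
  · rw [norm_smul, Real.norm_of_nonneg hc0.le] at hx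
    have hχs : ContDiff ℝ n (fun y => χ (c • y) - 1) :=
      ((χ.smooth n).comp (contDiff_const_smul c)).sub contDiff_const
    have hb := norm_iteratedFDeriv_mul_le hχs (Φ.smooth n) x (n := n) le_rfl
    have hk : ‖x‖ ^ k ≤ c * ‖x‖ ^ (k + 1) := by
      rw [pow_succ, mul_left_comm]
      exact le_mul_of_one_le_right (by positivity) hx
    calc ‖x‖ ^ k * _ ≤ (c * ‖x‖ ^ (k + 1)) * _ :=
          mul_le_mul hk hb (norm_nonneg _) (by positivity)
      _ = c * ∑ i ∈ Finset.range (n + 1), (n.choose i : ℝ) *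
            ‖iteratedFDeriv ℝ i (fun y => χ (c • y) - 1) x‖ *
              (‖x‖ ^ (k + 1) * ‖iteratedFDeriv ℝ (n - i) Φ x‖) := by
          rw [mul_assoc, Finset.mul_sum]
          congr 1
          exact Finset.sum_congr rfl fun i _ => by ring
      _ ≤ _ := by
          gcongr with i _
          · exact norm_iteratedFDeriv_dilate_sub_one_le χ hc0.le hc1 i x
          · exact Φ.le_seminorm ℂ (k + 1) (n - i) x

theorem tendsto_cutoff (χ Φ : 𝓢(E, ℂ)) (hχ : ∀ x, ‖x‖ < 1 → χ x = 1) :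
    Tendsto (fun N : ℕ => SchwartzMap.smulLeftCLM ℂ (fun x => χ ((1 / ((N : ℝ) + 1)) • x)) Φ)
      atTop (𝓝 Φ) := by
  rw [(schwartz_withSeminorms ℂ E ℂ).tendsto_nhds]
  rintro ⟨k, n⟩ ε hε
  have h := (tendsto_one_div_add_atTop_nhds_zero_nat (𝕜 := ℝ)).mul_const
    (∑ i ∈ Finset.range (n + 1), (n.choose i : ℝ) *
        (SchwartzMap.seminorm ℂ 0 i χ + 1) * SchwartzMap.seminorm ℂ (k + 1) (n - i) Φ)
  rw [zero_mul] at h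
  filter_upwards [h.eventually_lt_const hε] with N hN
  refine (seminorm_cutoff_sub_le χ Φ hχ Nat.one_div_pos_of_nat ?_ k n).trans_lt hN
  rw [div_le_one (by positivity)]
  linarith [(Nat.cast_nonneg N : (0 : ℝ) ≤ N)]

variable [FiniteDimensional ℝ E]

/-- A bump function at `c` with complex values, as a Schwartz function. -/
noncomputable def bump {c : E} (f : ContDiffBump c) : 𝓢(E, ℂ) :=
  HasCompactSupport.toSchwartzMap (f := fun x => (f x : ℂ))
    (f.hasCompactSupport.comp_left (g := Complex.ofReal) rfl) (Complex.ofRealCLM.contDiff.comp f.contDiff)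

@[simp] theorem bump_apply {c : E} (f : ContDiffBump c) (x : E) : bump f x = f x := rfl

theorem tsupport_bump {c : E} (f : ContDiffBump c) :
    tsupport (bump f) ⊆ Metric.closedBall c f.rOut := by
  rw [← f.tsupport_eq]
  exact closure_mono fun x hx h => hx (by simp [h])

/-- In place of a partition of unity, multipliers g that u does not notice are multiplied together:
each is 0 on a small ball, and finitely many balls cover the support of Φ. The product kills Φ
without changing the value of u. -/
theorem apply_eq_zero_of_hasCompactSupport (u : 𝓢'(E, ℂ)) (Φ : 𝓢(E, ℂ))
    (hc : HasCompactSupport Φ) (h : tsupport Φ ⊆ (dsupport u)ᶜ) : u Φ = 0 := by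
  have key : ∃ g : E → ℂ, g.HasTemperateGrowth ∧ (∀ x ∈ tsupport Φ, g x = 0) ∧
      ∀ Ψ : 𝓢(E, ℂ), u (SchwartzMap.smulLeftCLM ℂ g Ψ) = u Ψ := by
    refine hc.isCompact.induction_on (p := fun s => ∃ g : E → ℂ, g.HasTemperateGrowth ∧
      (∀ x ∈ s, g x = 0) ∧ ∀ Ψ : 𝓢(E, ℂ), u (SchwartzMap.smulLeftCLM ℂ g Ψ) = u Ψ)
      ⟨fun _ => 1, .const 1, by simp, by simp⟩ ?_ ?_ ?_
    · rintro s t hst ⟨g, hg, h0, h1⟩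
      exact ⟨g, hg, fun x hx => h0 x (hst hx), h1⟩
    · rintro s t ⟨g, hg, h0, h1⟩ ⟨g', hg', h0', h1'⟩
      refine ⟨g * g', hg.mul hg', ?_, fun Ψ => ?_⟩
      · rintro x (hx | hx)
        · simp [h0 x hx]
        · simp [h0' x hx]
      · rw [← SchwartzMap.smulLeftCLM_smulLeftCLM_apply hg hg', h1, h1']
    · intro x hx
      obtain ⟨s, hs, hso, hxs⟩ := (notMem_dsupport_iff x).1 (h hx)
      obtain ⟨r, hr, hrs⟩ := Metric.isOpen_iff.1 hso x hxs
      let f : ContDiffBump x := ⟨r / 3, r / 2, by positivity, by linarith⟩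
      have hf : (bump f : E → ℂ).HasTemperateGrowth := (bump f).hasTemperateGrowth
      -- The multiplier 1 - `bump f` is 0 on the inner ball, while `bump f` lives in the ball of
      -- radius r, where u vanishes; so u does not notice it.
      refine ⟨Metric.closedBall x (r / 3), mem_nhdsWithin_of_mem_nhds
        (Metric.closedBall_mem_nhds x (by positivity)), (fun _ : E => (1 : ℂ)) - ⇑(bump f),
        (Function.HasTemperateGrowth.const 1).sub hf, fun y hy => ?_, fun Ψ => ?_⟩
      · simp [f.one_of_mem_closedBall hy]
      · rw [SchwartzMap.smulLeftCLM_sub (.const 1) hf]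
        have : u (SchwartzMap.smulLeftCLM ℂ (bump f) Ψ) = 0 := by
          refine hs _ (((SchwartzMap.tsupport_smulLeftCLM_subset _ _).trans
            Set.inter_subset_right).trans ((tsupport_bump f).trans
              ((Metric.closedBall_subset_ball ?_).trans hrs)))
          change r / 2 < r
          linarith
        simp [this]
  obtain ⟨g, hg, h0, h1⟩ := key
  rw [← h1]
  have : SchwartzMap.smulLeftCLM ℂ g Φ = 0 := by
    ext x
    by_cases hx : x ∈ tsupport Φ
    · simp [hg, h0 x hx]
    · simp [hg, image_eq_zero_of_notMem_tsupport hx]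
  rw [this, map_zero]

/-- A tempered distribution vanishes on the complement of its support. -/
theorem isVanishingOn_compl_dsupport (u : 𝓢'(E, ℂ)) : IsVanishingOn u (dsupport u)ᶜ := by
  intro Φ hΦ
  -- The dilates of this bump give compactly supported approximations of Φ whose supports stay
  -- inside that of Φ; u vanishes on each, hence on the limit.
  let f : ContDiffBump (0 : E) := ⟨1, 2, one_pos, one_lt_two⟩
  have hlim := (u.cont.tendsto Φ).comp (tendsto_cutoff (bump f) Φ fun x hx => by
    rw [bump_apply, f.one_of_mem_closedBall (by simpa using hx.le), Complex.ofReal_one])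
  refine tendsto_nhds_unique hlim ?_
  refine tendsto_const_nhds.congr fun N => ?_
  have hsub := SchwartzMap.tsupport_smulLeftCLM_subset
    (fun x => bump f ((1 / ((N : ℝ) + 1)) • x)) Φ
  refine (apply_eq_zero_of_hasCompactSupport u _ ?_ ((hsub.trans Set.inter_subset_left).trans
    hΦ)).symm
  have hcs : HasCompactSupport (bump f) :=
    HasCompactSupport.of_support_subset_isCompact (isCompact_closedBall 0 f.rOut)
      ((subset_tsupport _).trans (tsupport_bump f))
  have : HasCompactSupport (fun x => bump f ((1 / ((N : ℝ) + 1)) • x)) :=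
    hcs.comp_homeomorph (Homeomorph.smulOfNeZero _ (by positivity))
  exact this.of_isClosed_subset (isClosed_tsupport _) (hsub.trans Set.inter_subset_right)

end Support

/-! ### The projected support of the Wigner transform -/

section Wigner

variable {d : ℕ}

theorem blockEquiv_inv_apply (T : GL (Fin d ⊕ Fin d) ℝ) (z : Eucl d × Eucl d) :
    blockEquiv T⁻¹ z = (blockEquiv T).symm z := by
  rw [ContinuousLinearEquiv.eq_symm_apply]
  change (pairEquiv d).symm (T.1 *ᵥ pairEquiv d ((pairEquiv d).symm (T⁻¹.1 *ᵥ pairEquiv d z))) = z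
  rw [LinearEquiv.apply_symm_apply, Matrix.mulVec_mulVec]
  have : T.1 * T⁻¹.1 = 1 := T.mul_inv
  rw [this, Matrix.one_mulVec, LinearEquiv.symm_apply_apply]

theorem slice_mapSnd {E F G : Type*} [NormedAddCommGroup E] [NormedSpace ℝ E]
    [NormedAddCommGroup F] [NormedSpace ℝ F] [NormedAddCommGroup G] [NormedSpace ℝ G]
    [FiniteDimensional ℝ E] [FiniteDimensional ℝ F] [FiniteDimensional ℝ G]
    (L : 𝓢(F, ℂ) →L[ℂ] 𝓢(G, ℂ)) (Φ : 𝓢(E × F, ℂ)) (x : E) :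
    slice x (mapSnd L Φ) = L (slice x Φ) := by
  ext y; simp

/-- This test function is chosen so that the transposes of the partial Fourier transform and of the
change of variables both cancel, leaving only the Jacobian factor. -/
theorem wigner_apply_mapSnd_fourierInv (T : GL (Fin d ⊕ Fin d) ℝ) (μ : 𝓢'(Eucl d, ℂ))
    (Φ : 𝓢(Eucl d × Eucl d, ℂ)) :
    wigner T μ (mapSnd (FourierTransform.fourierInvCLM ℂ 𝓢(Eucl d, ℂ))
      (SchwartzMap.compCLMOfContinuousLinearEquiv ℂ (blockEquiv T) Φ)) =
    ((|(T : Matrix (Fin d ⊕ Fin d) (Fin d ⊕ Fin d) ℝ).det|⁻¹ : ℝ) : ℂ) *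
      tensor μ (conjDist μ) Φ := by
  have h1 : ∀ Ψ : 𝓢(Eucl d × Eucl d, ℂ), mapSnd (FourierTransform.fourierCLM ℂ 𝓢(Eucl d, ℂ))
      (mapSnd (FourierTransform.fourierInvCLM ℂ 𝓢(Eucl d, ℂ)) Ψ) = Ψ := by
    rintro Ψ
    ext ⟨x, y⟩
    rw [mapSnd_apply, slice_mapSnd]
    simp
  change changeVar T (tensor μ (conjDist μ)) (mapSnd (FourierTransform.fourierCLM ℂ 𝓢(Eucl d, ℂ))
      (mapSnd (FourierTransform.fourierInvCLM ℂ 𝓢(Eucl d, ℂ)) _)) = _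
  rw [h1]
  change _ * tensor μ (conjDist μ) _ = _
  congr 2
  ext z
  simp

theorem hasCompactSupport_prod_mul {E F : Type*} [TopologicalSpace E] [TopologicalSpace F]
    [R1Space E] [R1Space F] {f : E → ℂ} {g : F → ℂ} (hf : HasCompactSupport f) (hg : HasCompactSupport g) :
    HasCompactSupport (fun z : E × F => f z.1 * g z.2) := by
  refine HasCompactSupport.of_support_subset_isCompact (hf.isCompact.prod hg.isCompact) ?_
  rintro ⟨x, y⟩ h
  exact ⟨subset_tsupport _ (left_ne_zero_of_mul h), subset_tsupport _ (right_ne_zero_of_mul h)⟩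

/-- `f ⊗ g` for compactly supported `f` and `g`. -/
noncomputable def prodMul {E F : Type*} [NormedAddCommGroup E] [NormedSpace ℝ E]
    [NormedAddCommGroup F] [NormedSpace ℝ F] (f : 𝓢(E, ℂ)) (g : 𝓢(F, ℂ))
    (hf : HasCompactSupport f) (hg : HasCompactSupport g) : 𝓢(E × F, ℂ) :=
  (hasCompactSupport_prod_mul hf hg).toSchwartzMap
    (((f.smooth ⊤).comp contDiff_fst).mul ((g.smooth ⊤).comp contDiff_snd))

/-- The slice of f ⊗ g at x is f(x) g, which ν sends to f(x) ν(g). -/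
theorem tensor_prodMul {E F : Type*} [NormedAddCommGroup E] [NormedSpace ℝ E]
    [NormedAddCommGroup F] [NormedSpace ℝ F] [FiniteDimensional ℝ E] [FiniteDimensional ℝ F]
    (μ : 𝓢'(E, ℂ)) (ν : 𝓢'(F, ℂ)) (f : 𝓢(E, ℂ)) (g : 𝓢(F, ℂ))
    (hf : HasCompactSupport f) (hg : HasCompactSupport g) :
    tensor μ ν (prodMul f g hf hg) = μ f * ν g := by
  have : evalSnd ν (prodMul f g hf hg) = ν g • f := by
    ext x
    have hs : slice x (prodMul f g hf hg) = f x • g := by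
      ext y; rfl
    rw [evalSnd_apply, hs, map_smul]
    simp [mul_comm]
  rw [tensor_apply, this, map_smul, smul_eq_mul, mul_comm]

/-- Shrinking V to a ball makes the support bounded, hence compact in finite dimension, as `prodMul`
requires. -/
theorem exists_compactSupport_ne_zero {E : Type*} [NormedAddCommGroup E] [NormedSpace ℝ E]
    [FiniteDimensional ℝ E] {μ : 𝓢'(E, ℂ)} {a : E} (ha : a ∈ dsupport μ) {V : Set E}
    (hV : V ∈ 𝓝 a) : ∃ f : 𝓢(E, ℂ), HasCompactSupport f ∧ tsupport f ⊆ V ∧ μ f ≠ 0 := by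
  obtain ⟨r, hr, hrV⟩ := Metric.mem_nhds_iff.1 hV
  obtain ⟨f, hf, h0⟩ := (mem_dsupport_iff_forall_exists_ne a).1 ha _
    (Metric.mem_ball_self hr) Metric.isOpen_ball
  exact ⟨f, HasCompactSupport.of_support_subset_isCompact (isCompact_closedBall a r)
    (((subset_tsupport _).trans hf).trans Metric.ball_subset_closedBall), hf.trans hrV, h0⟩

/-- Conjugating a test function for μ does not enlarge its support, and it turns the value of μ into
its conjugate. -/
theorem exists_conjDist_ne_zero {E : Type*} [NormedAddCommGroup E] [NormedSpace ℝ E]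
    [FiniteDimensional ℝ E] {μ : 𝓢'(E, ℂ)} {a : E} (ha : a ∈ dsupport μ) {V : Set E}
    (hV : V ∈ 𝓝 a) :
    ∃ f : 𝓢(E, ℂ), HasCompactSupport f ∧ tsupport f ⊆ V ∧ conjDist μ f ≠ 0 := by
  obtain ⟨f, hc, hs, h0⟩ := exists_compactSupport_ne_zero ha hV
  have hsupp : Function.support (f.postcompCLM (Complex.conjCLE : ℂ →L[ℝ] ℂ)) ⊆ tsupport f := by
    intro x hx
    refine subset_tsupport _ fun h => hx ?_
    simp [h]
  refine ⟨f.postcompCLM (Complex.conjCLE : ℂ →L[ℝ] ℂ),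
    HasCompactSupport.of_support_subset_isCompact hc.isCompact hsupp,
    (closure_minimal hsupp (isClosed_tsupport _)).trans hs, ?_⟩
  have e : (f.postcompCLM (Complex.conjCLE : ℂ →L[ℝ] ℂ)).postcompCLM
      (Complex.conjCLE : ℂ →L[ℝ] ℂ) = f := by
    ext x; simp
  rw [conjDist_apply, e]
  simpa using h0

/-- The closure of the projection of the support of `W_T(μ)` contains the projection of
`T⁻¹ (supp μ × supp μ)`. -/
theorem fst_symm_mem_closure_proj₁ (T : GL (Fin d ⊕ Fin d) ℝ) {μ : 𝓢'(Eucl d, ℂ)} {a b : Eucl d}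
    (ha : a ∈ dsupport μ) (hb : b ∈ dsupport μ) :
    ((blockEquiv T).symm (a, b)).1 ∈ closure (proj₁ (dsupport (wigner T μ))) := by
  by_contra hx
  have hc : Continuous fun z => ((blockEquiv T).symm z).1 :=
    continuous_fst.comp (blockEquiv T).symm.continuous
  have hU : (fun z => ((blockEquiv T).symm z).1) ⁻¹'
      (closure (proj₁ (dsupport (wigner T μ))))ᶜ ∈ 𝓝 (a, b) :=
    hc.continuousAt.preimage_mem_nhds (isClosed_closure.isOpen_compl.mem_nhds hx)
  obtain ⟨V, hV, V', hV', hVU⟩ := mem_nhds_prod_iff.1 hU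
  obtain ⟨f, hfc, hfs, hf⟩ := exists_compactSupport_ne_zero ha hV
  obtain ⟨g, hgc, hgs, hg⟩ := exists_conjDist_ne_zero hb hV'
  -- Testing W_T(μ) on Ψ gives a nonzero multiple of μ(f) times `conjDist μ g`, although Ψ will be
  -- seen to live off the support of W_T(μ).
  let Φ := SchwartzMap.compCLMOfContinuousLinearEquiv ℂ (blockEquiv T) (prodMul f g hfc hgc)
  let Ψ := mapSnd (FourierTransform.fourierInvCLM ℂ 𝓢(Eucl d, ℂ)) Φ
  let K := (fun z => ((blockEquiv T).symm z).1) '' (tsupport f ×ˢ tsupport g)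
  have hK : IsCompact K := (hfc.isCompact.prod hgc.isCompact).image hc
  -- The inverse Fourier transform acts slice by slice, and a slice of Φ over a point outside K is
  -- zero. Nothing is claimed about the extent of Ψ in the second variable.
  have hΨ : ∀ z, Ψ z ≠ 0 → z.1 ∈ K := by
    rintro ⟨x, y⟩ hz
    by_contra hxK
    refine hz ?_
    have : slice x Φ = 0 := by
      ext t
      by_contra ht
      refine hxK ⟨blockEquiv T (x, t), ⟨subset_tsupport _ (left_ne_zero_of_mul ht),
        subset_tsupport _ (right_ne_zero_of_mul ht)⟩, ?_⟩
      simp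
    simp [Ψ, this]
  have hsupp : tsupport Ψ ⊆ (dsupport (wigner T μ))ᶜ := by
    intro z hz hzW
    have : z.1 ∈ K := closure_minimal (t := Prod.fst ⁻¹' K) hΨ
      (hK.isClosed.preimage continuous_fst) hz
    obtain ⟨w, hw, hwz⟩ := this
    exact hVU ⟨hfs hw.1, hgs hw.2⟩ (by
      change ((blockEquiv T).symm w).1 ∈ _
      simp only at hwz
      rw [hwz]
      exact subset_closure ⟨z.2, hzW⟩)
  have h0 := isVanishingOn_compl_dsupport (wigner T μ) Ψ hsupp
  rw [wigner_apply_mapSnd_fourierInv, tensor_prodMul] at h0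
  have hdet : (T : Matrix (Fin d ⊕ Fin d) (Fin d ⊕ Fin d) ℝ).det ≠ 0 :=
    ((Matrix.isUnit_iff_isUnit_det _).1 T.isUnit).ne_zero
  have : ((|(T : Matrix (Fin d ⊕ Fin d) (Fin d ⊕ Fin d) ℝ).det|⁻¹ : ℝ) : ℂ) ≠ 0 := by
    simpa using hdet
  exact mul_ne_zero this (mul_ne_zero hf hg) h0

end Wigner

/-! ### Discrete sets and the arithmetic of the example -/

theorem IsDiscreteSet.isClosed {X : Type*} [TopologicalSpace X] {S : Set X}
    (h : IsDiscreteSet S) : IsClosed S :=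
  isClosed_iff_accPt.2 fun x hx => (h x hx).elim

theorem IsDiscreteSet.mono {X : Type*} [TopologicalSpace X] {S S' : Set X}
    (h : IsDiscreteSet S) (hs : S' ⊆ S) : IsDiscreteSet S' :=
  fun x hx => h x (hx.mono (principal_mono.2 hs))

/-- An injective continuous map carries accumulation points to accumulation points, since punctured
neighbourhoods stay punctured. -/
theorem IsDiscreteSet.preimage {X Y : Type*} [TopologicalSpace X] [TopologicalSpace Y]
    {S : Set Y} (h : IsDiscreteSet S) {f : X → Y} (hf : Continuous f)
    (hinj : Function.Injective f) : IsDiscreteSet (f ⁻¹' S) := by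
  intro x hx
  have := hx.map hf.continuousAt hinj
  rw [map_principal] at this
  exact h _ (this.mono (principal_mono.2 (Set.image_preimage_subset f S)))

/-- Points of different pieces differ by a half-integer in the second coordinate, so by at least
1/2. Distinct points of one piece differ by at least 1 in some coordinate, because √2 ≥ 1. -/
theorem isUniformlyDiscrete_exampleSet : IsUniformlyDiscrete exampleSet := by
  have hint : ∀ n : ℤ, n ≠ 0 → (1 : ℝ) ≤ |(n : ℝ)| := fun n hn => by
    exact_mod_cast Int.one_le_abs hn
  have hhalf : ∀ n : ℤ, (1 / 2 : ℝ) ≤ |(n : ℝ) + 1 / 2| := fun n => by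
    rcases le_or_gt 0 n with h | h
    · have : (0 : ℝ) ≤ n := by exact_mod_cast h
      rw [abs_of_nonneg (by linarith)]; linarith
    · have : (n : ℝ) ≤ -1 := by exact_mod_cast Int.le_sub_one_of_lt h
      rw [abs_of_nonpos (by linarith)]; linarith
  have hcoord : ∀ (x y : Eucl 2) (i : Fin 2), |x i - y i| ≤ dist x y := fun x y i => by
    rw [dist_eq_norm, ← Real.norm_eq_abs]
    exact PiLp.norm_apply_le (x - y) i
  refine ⟨1 / 2, by norm_num, ?_⟩
  rintro r (⟨m, n, rfl⟩ | ⟨m, n, rfl⟩) s (⟨p, q, rfl⟩ | ⟨p, q, rfl⟩) hrs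
  · rcases ne_or_eq n q with h | rfl
    · refine le_trans ?_ (hcoord _ _ 1)
      have := hint (n - q) (sub_ne_zero.2 h)
      push_cast at this
      simp; linarith
    · have h : m ≠ p := by rintro rfl; exact hrs rfl
      refine le_trans ?_ (hcoord _ _ 0)
      have := hint (m - p) (sub_ne_zero.2 h)
      push_cast at this
      simp; linarith
  · refine le_trans ?_ (hcoord _ _ 1)
    have := hhalf (q - n)
    push_cast at this
    rw [abs_sub_comm]
    refine this.trans_eq (congrArg abs ?_)
    simp only [Fin.isValue, Matrix.cons_val_one, Matrix.cons_val_fin_one]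
    ring
  · refine le_trans ?_ (hcoord _ _ 1)
    have := hhalf (n - q)
    push_cast at this
    refine this.trans_eq (congrArg abs ?_)
    simp only [Fin.isValue, Matrix.cons_val_one, Matrix.cons_val_fin_one]
    ring
  · rcases ne_or_eq n q with h | rfl
    · refine le_trans ?_ (hcoord _ _ 1)
      have := hint (n - q) (sub_ne_zero.2 h)
      push_cast at this
      simp; linarith
    · have h : m ≠ p := by rintro rfl; exact hrs rfl
      refine le_trans ?_ (hcoord _ _ 0)
      have := hint (m - p) (sub_ne_zero.2 h)
      push_cast at this
      have h2 : (1 : ℝ) ≤ √2 := Real.one_le_sqrt.2 one_le_two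
      have e : √2 * (m : ℝ) - √2 * p = √2 * (m - p) := by ring
      simp only [Matrix.cons_val_zero]
      rw [e, abs_mul, abs_of_nonneg (by positivity : 0 ≤ √2)]
      nlinarith

/-- If the translates by `ℤ²` of the multiples of `w` form a discrete set, then some nonzero
multiple of `w` is in `ℤ²`. -/
theorem exists_mul_eq_int_of_isDiscreteSet {S : Set (Eucl 2)} (hS : IsDiscreteSet S)
    (v w : Eucl 2)
    (h : ∀ k m n : ℤ, !₂[(m : ℝ), (n : ℝ)] + ((k : ℝ) • w + v) ∈ S) :
    ∃ k : ℤ, k ≠ 0 ∧ ∀ i, ∃ n : ℤ, (k : ℝ) * w i = n := by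
  -- Each kw is reduced modulo ℤ² to the unit square before the shift by v.
  let x : ℤ → Eucl 2 := fun k => !₂[Int.fract ((k : ℝ) * w 0), Int.fract ((k : ℝ) * w 1)] + v
  have hx : ∀ k, x k ∈ S := by
    intro k
    convert h k (-⌊(k : ℝ) * w 0⌋) (-⌊(k : ℝ) * w 1⌋) using 1
    ext i
    fin_cases i <;> simp [x, ← Int.self_sub_floor] <;> ring
  -- Any radius at least √2, the diagonal of the unit square, would do.
  have hcpt : Set.range x ⊆ Metric.closedBall v 2 := by
    rintro _ ⟨k, rfl⟩
    rw [Metric.mem_closedBall, dist_eq_norm]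
    have h0 := Int.fract_nonneg ((k : ℝ) * w 0)
    have h1 := Int.fract_nonneg ((k : ℝ) * w 1)
    have h0' := Int.fract_lt_one ((k : ℝ) * w 0)
    have h1' := Int.fract_lt_one ((k : ℝ) * w 1)
    simp only [x, add_sub_cancel_right, EuclideanSpace.norm_eq, Fin.sum_univ_two,
      Real.norm_eq_abs, sq_abs]
    rw [Real.sqrt_le_left (by norm_num)]
    simp
    nlinarith
  -- An injective sequence in a compact ball would accumulate, against discreteness. A coincidence
  -- between the indices k and l then puts (k - l)w in ℤ².
  have hnotinj : ¬ Function.Injective x := by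
    intro hinj
    obtain ⟨y, -, hy⟩ := (Set.infinite_range_of_injective hinj).exists_accPt_of_subset_isCompact
      (isCompact_closedBall v 2) hcpt
    exact hS y (hy.mono (principal_mono.2 (Set.range_subset_iff.2 hx)))
  simp only [Function.Injective, not_forall] at hnotinj
  obtain ⟨k, l, hkl, hne⟩ := hnotinj
  refine ⟨k - l, sub_ne_zero.2 hne, fun i => ?_⟩
  have h2 := congrArg (fun z : Eucl 2 => z i) (add_right_cancel hkl)
  have h3 : Int.fract ((k : ℝ) * w i) = Int.fract ((l : ℝ) * w i) := by
    fin_cases i <;> simpa using h2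
  obtain ⟨n, hn⟩ := Int.fract_eq_fract.1 h3
  exact ⟨n, by push_cast; linarith⟩

theorem not_isDiscreteSet_exampleSet_add_matImage {M : Matrix (Fin 2) (Fin 2) ℝ}
    (hM : M.det ≠ 0) : ¬ IsDiscreteSet (exampleSet + matImage M exampleSet) := by
  intro hS
  let w : Eucl 2 := WithLp.toLp 2 (M *ᵥ ![1, 0])
  let v : Eucl 2 := WithLp.toLp 2 (M *ᵥ ![0, 1 / 2])
  obtain ⟨k, hk, hkw⟩ := exists_mul_eq_int_of_isDiscreteSet hS 0 w fun k m n =>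
    Set.add_mem_add (Or.inl ⟨m, n, rfl⟩) ⟨!₂[(k : ℝ), ((0 : ℤ) : ℝ)], Or.inl ⟨k, 0, rfl⟩, by
      ext i; fin_cases i <;> simp [w, Matrix.mulVec, dotProduct, mul_comm]⟩
  -- The points (√2 k, 1/2) of the second piece have image k√2 w + v under M; the half-integer
  -- offset contributes only the harmless shift v.
  obtain ⟨l, hl, hlw⟩ := exists_mul_eq_int_of_isDiscreteSet hS v (√2 • w) fun k m n =>
    Set.add_mem_add (Or.inl ⟨m, n, rfl⟩) ⟨!₂[√2 * (k : ℝ), ((0 : ℤ) : ℝ) + 1 / 2],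
      Or.inr ⟨k, 0, rfl⟩, by
      ext i; fin_cases i <;> simp [w, v, Matrix.mulVec, dotProduct] <;> ring⟩
  obtain ⟨i, hi⟩ : ∃ i, w i ≠ 0 := by
    by_contra! hw
    have h0 : M *ᵥ ![1, 0] = 0 := funext hw
    have := Matrix.eq_zero_of_mulVec_eq_zero hM h0
    simpa using congrFun this 0
  obtain ⟨a, ha⟩ := hkw i
  obtain ⟨b, hb⟩ := hlw i
  have hkr : (k : ℝ) ≠ 0 := by exact_mod_cast hk
  have hlr : (l : ℝ) ≠ 0 := by exact_mod_cast hl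
  have ha0 : (a : ℝ) ≠ 0 := by rw [← ha]; exact mul_ne_zero hkr hi
  -- From k wᵢ = a and l√2 wᵢ = b, elimination of wᵢ gives √2 = bk/(la).
  refine irrational_sqrt_two ⟨(b * k : ℤ) / (l * a : ℤ), ?_⟩
  push_cast
  rw [div_eq_iff (mul_ne_zero hlr ha0), ← ha, ← hb]
  simp only [PiLp.smul_apply, smul_eq_mul]
  ring

/-- For a block matrix `T⁻¹` with upper blocks `A`, `B`, the projection of the support of `W_T(μ)`
is discrete only if `supp μ + A⁻¹ B (supp μ)` is. -/
theorem isDiscreteSet_dsupport_add_matImage {d : ℕ} {μ : 𝓢'(Eucl d, ℂ)}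
    {T : GL (Fin d ⊕ Fin d) ℝ} {A B C D : Matrix (Fin d) (Fin d) ℝ}
    (hT : ((T⁻¹ : GL (Fin d ⊕ Fin d) ℝ) : Matrix (Fin d ⊕ Fin d) (Fin d ⊕ Fin d) ℝ) =
      Matrix.fromBlocks A B C D) (hA : A.det ≠ 0)
    (hW : IsDiscreteSet (proj₁ (Distribution.dsupport (wigner T μ)))) :
    IsDiscreteSet (Distribution.dsupport μ + matImage (A⁻¹ * B) (Distribution.dsupport μ)) := by
  have hinj : Function.Injective fun x : Eucl d => (WithLp.toLp 2 (A *ᵥ x.ofLp) : Eucl d) := by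
    intro x y hxy
    have h1 : A *ᵥ x.ofLp = A *ᵥ y.ofLp := congrArg WithLp.ofLp hxy
    have h2 : A *ᵥ (x.ofLp - y.ofLp) = 0 := by rw [Matrix.mulVec_sub, h1, sub_self]
    exact WithLp.ofLp_injective 2 (sub_eq_zero.1 (Matrix.eq_zero_of_mulVec_eq_zero hA h2))
  have hcont : Continuous fun x : Eucl d => (WithLp.toLp 2 (A *ᵥ x.ofLp) : Eucl d) := by
    fun_prop
  -- The sumset lies in the preimage under A because A(a + A⁻¹Bb) = Aa + Bb, the first component of
  -- T⁻¹(a, b).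
  refine (hW.preimage hcont hinj).mono ?_
  rintro _ ⟨a, ha, _, ⟨b, hb, rfl⟩, rfl⟩
  have h := fst_symm_mem_closure_proj₁ T ha hb
  -- Having no accumulation point makes the projection closed, so membership in its closure is
  -- membership in the projection itself.
  rw [hW.isClosed.closure_eq, ← blockEquiv_inv_apply, blockEquiv_apply _ A B C D hT] at h
  have hAA : A * (A⁻¹ * B) = B := Matrix.mul_nonsing_inv_cancel_left A B (Ne.isUnit hA)
  change WithLp.toLp 2 (A *ᵥ (a.ofLp + (A⁻¹ * B) *ᵥ b.ofLp)) ∈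
    proj₁ (Distribution.dsupport (wigner T μ))
  rwa [Matrix.mulVec_add, Matrix.mulVec_mulVec, hAA]

end MatrixWigner

theorem mainTheorem5 :
    MatrixWigner.IsUniformlyDiscrete MatrixWigner.exampleSet ∧
    (∀ A B : Matrix (Fin 2) (Fin 2) ℝ, A.det ≠ 0 → B.det ≠ 0 →
      ¬ MatrixWigner.IsDiscreteSet
        (MatrixWigner.exampleSet + MatrixWigner.matImage (A⁻¹ * B) MatrixWigner.exampleSet)) ∧
    ¬ ∃ (μ : 𝓢'(MatrixWigner.Eucl 2, ℂ)) (T : GL (Fin 2 ⊕ Fin 2) ℝ)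
        (A B C D : Matrix (Fin 2) (Fin 2) ℝ),
      ((T⁻¹ : GL (Fin 2 ⊕ Fin 2) ℝ) : Matrix (Fin 2 ⊕ Fin 2) (Fin 2 ⊕ Fin 2) ℝ) =
        Matrix.fromBlocks A B C D ∧
      A.det ≠ 0 ∧ B.det ≠ 0 ∧
      Distribution.dsupport μ = MatrixWigner.exampleSet ∧
      MatrixWigner.IsDiscreteSet
        (MatrixWigner.proj₁ (Distribution.dsupport (MatrixWigner.wigner T μ))) := by
  have hdet : ∀ A B : Matrix (Fin 2) (Fin 2) ℝ, A.det ≠ 0 → B.det ≠ 0 → (A⁻¹ * B).det ≠ 0 := by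
    intro A B hA hB
    rw [Matrix.det_mul, Matrix.det_nonsing_inv, Ring.inverse_eq_inv']
    exact mul_ne_zero (inv_ne_zero hA) hB
  have hnot := fun A B hA hB =>
    MatrixWigner.not_isDiscreteSet_exampleSet_add_matImage (hdet A B hA hB)
  refine ⟨MatrixWigner.isUniformlyDiscrete_exampleSet, hnot, ?_⟩
  rintro ⟨μ, T, A, B, C, D, hT, hA, hB, hμ, hW⟩
  exact hnot A B hA hB (hμ ▸ MatrixWigner.isDiscreteSet_dsupport_add_matImage hT hA hW)
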